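/- A polygon is given by a simple closed polygonal chain in the plane (its boundary), specified by its vertices $v_0,\dots,v_{n-1}$ in counterclockwise order; any three consecutive vertices are non-collinear, and distinct edges meet only when they are consecutive, and then only in their common vertex. Its interior $\mathrm{int}(P)$ is the open set enclosed by the boundary. Two points $p,q$ see each other if the segment $pq$ without its endpoints lies in $\mathrm{int}(P)$. The polygon $P$ is starshaped if some point of $\mathrm{int}(P)$ sees every point of $\mathrm{int}(P)$. An open edge is an edge of $P$ without its two endpoints. A set $S$ of open edges of $P$ is an open edge guard set if every point of $\mathrm{int}(P)$ is seen by some point of some edge in $S$; it is hidden if for no two distinct edges $g_1,g_2\in S$ there are points $p\in g_1$ and $q\in g_2$ that see each other. Lemma. There exists a starshaped polygon that does not admit a hidden open edge guard set; that is, no set of its open edges is both an open edge guard set and hidden. -/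

import Mathlib

/-- The Euclidean plane. -/
abbrev Plane : Type := EuclideanSpace ℝ (Fin 2)

namespace Polygon

variable {n : ℕ}

/-- The closed polygonal chain through the vertices is simple: consecutive vertices make a genuine
corner, consecutive edges meet exactly in their common vertex, and all other pairs of distinct
edges are disjoint. -/
structure IsSimple [NeZero n] (P : Polygon Plane n) : Prop where
  nondegenerate : P.HasNondegenerateVertices ℝ
  consecutive : ∀ i : Fin n,
    P.edgeSet ℝ i ∩ P.edgeSet ℝ (finRotate n i) = {P (finRotate n i)}
  nonconsecutive : ∀ i j : Fin n, i ≠ j → j ≠ finRotate n i → i ≠ finRotate n j →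
    Disjoint (P.edgeSet ℝ i) (P.edgeSet ℝ j)

/-- The vertices of a simple polygon are listed in counterclockwise order: the signed area
enclosed by the boundary (here, twice that area, by the shoelace formula) is positive. -/
def IsCounterclockwise (P : Polygon Plane n) : Prop :=
  0 < ∑ i : Fin n, (P i 0 * P (finRotate n i) 1 - P (finRotate n i) 0 * P i 1)

/-- The interior of a polygon, the open set enclosed by its boundary: the union of the bounded
connected components of the complement of the boundary. -/
def interiorRegion (P : Polygon Plane n) : Set Plane :=
  {x | x ∉ P.boundary ℝ ∧ Bornology.IsBounded (connectedComponentIn (P.boundary ℝ)ᶜ x)}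

/-- Two points see each other if the segment between them, without its endpoints, lies in the
interior of the polygon. -/
def Sees (P : Polygon Plane n) (p q : Plane) : Prop :=
  openSegment ℝ p q ⊆ P.interiorRegion

/-- A polygon is starshaped if some interior point sees every point of the interior. -/
def IsStarshaped (P : Polygon Plane n) : Prop :=
  ∃ k ∈ P.interiorRegion, ∀ x ∈ P.interiorRegion, P.Sees k x

/-- The `i`-th edge of the polygon, without its endpoints. -/
def openEdge (P : Polygon Plane n) (i : Fin n) : Set Plane :=
  openSegment ℝ (P i) (P (finRotate n i))

/-- The open edges with index in `S` form an open edge guard set: every point of the interior is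
seen from some point of some edge in `S`. -/
def IsOpenEdgeGuardSet (P : Polygon Plane n) (S : Set (Fin n)) : Prop :=
  ∀ x ∈ P.interiorRegion, ∃ i ∈ S, ∃ p ∈ P.openEdge i, P.Sees x p

/-- The open edges with index in `S` are hidden: no two of them see each other, that is, no point
of one sees a point of another. -/
def IsHiddenOpenEdgeSet (P : Polygon Plane n) (S : Set (Fin n)) : Prop :=
  ∀ i ∈ S, ∀ j ∈ S, i ≠ j → ¬ ∃ p ∈ P.openEdge i, ∃ q ∈ P.openEdge j, P.Sees p q

end Polygon

/-! The example is an 18-gon with nine spikes, star-shaped about the origin and invariant under a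
linear map of order three. Fifteen interior points serve as witnesses, five per third of the
polygon: one close to each of the three spike tips and two more. For each witness, every edge
outside a short list is hidden from it entirely by a single other edge (`blocks_of_mem_witnesses`,
`not_sees_ofInt`), so a guard set must contain an edge from each list. On the other hand, explicit
sightlines join points of certain pairs of edges (`of_mem_sightlines`, `sees_ofInt`), so a hidden
set contains no such pair. An exhaustive search (`noSelection_witnesses`) shows that these demands
are incompatible. The data may be one-sided: lists may be too long and sightlines may be missing, as
long as the search still fails.

Topology enters only through `interiorRegion_eq`, which identifies the interior with the set where a
piecewise linear radial gauge is less than 1. Everything else reduces to signs of integer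
determinants. -/

/-! ### Orientation tests for segments in the plane -/

/-- The signed area of the parallelogram spanned by two plane vectors. -/
def cross (p q : Plane) : ℝ := p 0 * q 1 - p 1 * q 0

/-- Twice the signed area of the triangle `a b c`. -/
def orient (a b c : Plane) : ℝ := cross (b - a) (c - a)

theorem orient_eq (a b c : Plane) :
    orient a b c = (b 0 - a 0) * (c 1 - a 1) - (b 1 - a 1) * (c 0 - a 0) := by
  simp [orient, cross]

theorem plane_ext {p q : Plane} (h0 : p 0 = q 0) (h1 : p 1 = q 1) : p = q := by
  ext i; fin_cases i <;> assumption

@[simp] theorem cross_zero_right (p : Plane) : cross p 0 = 0 := by simp [cross]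

@[simp] theorem cross_zero_left (p : Plane) : cross 0 p = 0 := by simp [cross]

theorem cross_smul_right (p q : Plane) (t : ℝ) : cross p (t • q) = t * cross p q := by
  simp [cross]; ring

theorem cross_smul_left (p q : Plane) (t : ℝ) : cross (t • p) q = t * cross p q := by
  simp [cross]; ring

theorem continuous_cross_right (p : Plane) : Continuous fun x => cross p x := by
  unfold cross; fun_prop

theorem continuous_cross_left (p : Plane) : Continuous fun x => cross x p := by
  unfold cross; fun_prop

/-- Cramer's rule in the plane. -/
theorem cross_smul_eq (a b x : Plane) :
    cross a b • x = cross x b • a + cross a x • b := by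
  apply plane_ext <;> simp [cross] <;> ring

theorem orient_smul_add (a b c d : Plane) {s t : ℝ} (h : s + t = 1) :
    orient a b (s • c + t • d) = s * orient a b c + t * orient a b d := by
  obtain rfl : s = 1 - t := by linarith
  simp [orient_eq]; ring

theorem orient_right_smul_add (a b c d : Plane) {s t : ℝ} (h : s + t = 1) :
    orient a (s • b + t • c) d = s * orient a b d + t * orient a c d := by
  obtain rfl : s = 1 - t := by linarith
  simp [orient_eq]; ring

theorem orient_eq_zero_of_mem_segment {a b x : Plane} (hx : x ∈ segment ℝ a b) :
    orient a b x = 0 := by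
  obtain ⟨s, t, -, -, h, rfl⟩ := hx
  rw [orient_smul_add _ _ _ _ h]
  simp [orient_eq]; right; ring

theorem disjoint_segment_of_orient_mul_pos {a b c d : Plane}
    (h : 0 < orient a b c * orient a b d) : Disjoint (segment ℝ a b) (segment ℝ c d) := by
  rw [Set.disjoint_left]
  rintro x hx ⟨s, t, hs, ht, hst, rfl⟩
  have h0 := orient_eq_zero_of_mem_segment hx
  rw [orient_smul_add _ _ _ _ hst] at h0
  have h1 : s * orient a b c ^ 2 + t * (orient a b c * orient a b d) = 0 := by
    linear_combination orient a b c * h0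
  have hc : 0 < orient a b c ^ 2 := by
    have : orient a b c ≠ 0 := by
      intro h'
      simp [h'] at h
    positivity
  rcases hs.eq_or_lt with rfl | hs
  · obtain rfl : t = 1 := by linarith
    linarith
  · nlinarith [mul_pos hs hc, mul_nonneg ht h.le]

/-- One of `p`, `q` may lie on the line `c d`; the open segment is still strictly to its left. This
covers sightlines that start on the edge `c d` itself. -/
theorem disjoint_openSegment_segment {p q c d : Plane}
    (hp : 0 ≤ orient c d p) (hq : 0 ≤ orient c d q) (hpq : 0 < orient c d p + orient c d q) :
    Disjoint (openSegment ℝ p q) (segment ℝ c d) := by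
  rw [Set.disjoint_right]
  rintro x hx ⟨s, t, hs, ht, hst, rfl⟩
  have h0 := orient_eq_zero_of_mem_segment hx
  rw [orient_smul_add _ _ _ _ hst] at h0
  have h1 := mul_nonneg hs.le hp
  have h2 := mul_nonneg ht.le hq
  have h3 : orient c d p = 0 := by
    have : s * orient c d p = 0 := by linarith
    simpa [hs.ne'] using this
  have h4 : orient c d q = 0 := by
    have : t * orient c d q = 0 := by linarith
    simpa [ht.ne'] using this
  linarith

theorem segment_inter_segment_of_orient_ne_zero {a b c : Plane} (h : orient a b c ≠ 0) :
    segment ℝ a b ∩ segment ℝ b c = {b} := by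
  ext x
  constructor
  · rintro ⟨h1, s, t, hs, ht, hst, rfl⟩
    have h0 := orient_eq_zero_of_mem_segment h1
    rw [orient_smul_add _ _ _ _ hst,
      orient_eq_zero_of_mem_segment (right_mem_segment ℝ a b)] at h0
    obtain rfl : t = 0 := by simpa [h] using h0
    obtain rfl : s = 1 := by linarith
    simp
  · rintro rfl
    exact ⟨right_mem_segment ℝ _ _, left_mem_segment ℝ _ _⟩

theorem affineIndependent_of_orient_ne_zero {a b c : Plane} (h : orient a b c ≠ 0) :
    AffineIndependent ℝ ![a, b, c] := by
  rw [affineIndependent_iff_not_collinear_set, collinear_iff_of_mem (p₀ := a) (by simp)]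
  rintro ⟨v, hv⟩
  obtain ⟨r, rfl⟩ := hv b (by simp)
  obtain ⟨s, rfl⟩ := hv c (by simp)
  apply h
  simp [orient_eq]; ring

/-- If `x` lies strictly to the left of the line from `c` to `d`, the segment `a b` lies weakly to
its right and is seen from `x` within the angle spanned by `c` and `d`, then the segment from `x`
to any point strictly between `a` and `b` crosses the segment `c d`. -/
theorem exists_mem_openSegment_mem_segment {x a b c d p : Plane}
    (hx : 0 < orient c d x) (ha : orient c d a ≤ 0) (hb : orient c d b ≤ 0)
    (hab : orient c d a + orient c d b < 0)
    (hac : orient x a c ≤ 0) (hbc : orient x b c ≤ 0)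
    (had : 0 ≤ orient x a d) (hbd : 0 ≤ orient x b d) (hp : p ∈ openSegment ℝ a b) :
    ∃ y ∈ openSegment ℝ x p, y ∈ segment ℝ c d := by
  obtain ⟨s, t, hs, ht, hst, rfl⟩ := hp
  set p := s • a + t • b with hpdef
  -- Each condition on `a` and `b` is affine in the point, hence passes to `p`; `hab` keeps it
  -- strict even if one of `a`, `b` lies on the line `c d`.
  have hpn : orient c d p < 0 := by
    rw [hpdef, orient_smul_add _ _ _ _ hst]
    rcases ha.eq_or_lt with h | h
    · nlinarith
    · nlinarith
  have hpc : orient x p c ≤ 0 := by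
    rw [hpdef, orient_right_smul_add _ _ _ _ hst]
    nlinarith
  have hpd : 0 ≤ orient x p d := by
    rw [hpdef, orient_right_smul_add _ _ _ _ hst]
    positivity
  clear_value p
  -- Both sides equal `cross (p - x) (d - c)`, so one denominator normalizes the weights of the
  -- intersection point along both segments.
  have hsum : orient x p d - orient x p c = orient c d x - orient c d p := by
    simp only [orient_eq]; ring
  set D := orient c d x - orient c d p with hD
  have hDpos : 0 < D := by linarith
  refine ⟨(-orient c d p / D) • x + (orient c d x / D) • p,
    ⟨_, _, div_pos (by linarith) hDpos, div_pos hx hDpos, ?_, rfl⟩,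
    ⟨orient x p d / D, -orient x p c / D, div_nonneg hpd hDpos.le,
      div_nonneg (by linarith) hDpos.le, ?_, ?_⟩⟩
  · rw [← add_div, div_eq_one_iff_eq hDpos.ne']; linarith
  · rw [← add_div, div_eq_one_iff_eq hDpos.ne']; linarith
  · have key : orient x p d • c + (-orient x p c) • d = (-orient c d p) • x + orient c d x • p := by
      apply plane_ext <;> simp [orient_eq] <;> ring
    simp only [div_eq_inv_mul, mul_smul, ← smul_add, key]

/-! ### The interior of a polygon star-shaped about the origin -/

namespace Polygon

variable {n : ℕ}

theorem edgeSet_eq_segment (P : Polygon Plane n) (i : Fin n) :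
    P.edgeSet ℝ i = segment ℝ (P i) (P (finRotate n i)) := by
  rw [edgeSet, affineSegment_eq_segment]

theorem boundary_eq (P : Polygon Plane n) :
    P.boundary ℝ = ⋃ i, segment ℝ (P i) (P (finRotate n i)) := by
  simp only [boundary, edgeSet_eq_segment]

/-- The closed angular sector at the origin spanned by the `i`-th edge. -/
def sector (P : Polygon Plane n) (i : Fin n) : Set Plane :=
  {x | 0 ≤ cross (P i) x ∧ 0 ≤ cross x (P (finRotate n i))}

/-- A form which, on the `i`-th sector, is smaller than `cross (P i) (P (finRotate n i))` exactly
at the points on the near side of the `i`-th edge. -/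
def edgeForm (P : Polygon Plane n) (i : Fin n) (x : Plane) : ℝ :=
  cross (P i) x + cross x (P (finRotate n i))

/-- The points of the plane which are separated from the origin by no edge. -/
def starRegion (P : Polygon Plane n) : Set Plane :=
  {x | ∃ i, x ∈ P.sector i ∧ P.edgeForm i x < cross (P i) (P (finRotate n i))}

/-- The edges of the polygon, in order, are traversed counterclockwise around the origin, and their
sectors cover the plane without overlap. -/
structure IsStarAboutZero (P : Polygon Plane n) : Prop where
  cross_pos : ∀ i, 0 < cross (P i) (P (finRotate n i))
  cover : ∀ x, ∃ i, x ∈ P.sector i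
  consistent : ∀ i j x, x ∈ P.sector i → x ∈ P.sector j →
    P.edgeForm i x * cross (P j) (P (finRotate n j)) =
      P.edgeForm j x * cross (P i) (P (finRotate n i))

theorem edgeForm_smul (P : Polygon Plane n) (i : Fin n) (t : ℝ) (x : Plane) :
    P.edgeForm i (t • x) = t * P.edgeForm i x := by
  simp only [edgeForm, cross_smul_left, cross_smul_right]; ring

theorem smul_mem_sector {P : Polygon Plane n} {i : Fin n} {t : ℝ} (ht : 0 ≤ t) {x : Plane}
    (hx : x ∈ P.sector i) : t • x ∈ P.sector i := by
  refine ⟨?_, ?_⟩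
  · rw [cross_smul_right]; exact mul_nonneg ht hx.1
  · rw [cross_smul_left]; exact mul_nonneg ht hx.2

theorem isClosed_sector (P : Polygon Plane n) (i : Fin n) : IsClosed (P.sector i) :=
  (isClosed_le continuous_const (continuous_cross_right _)).inter
    (isClosed_le continuous_const (continuous_cross_left _))

theorem continuous_edgeForm (P : Polygon Plane n) (i : Fin n) : Continuous (P.edgeForm i) :=
  (continuous_cross_right _).add (continuous_cross_left _)

namespace IsStarAboutZero

variable {P : Polygon Plane n}

/-- By Cramer's rule the two summands of `edgeForm`, divided by the determinant, are the coordinates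
of `x` in the basis of the edge's endpoints. -/
theorem mem_segment_iff (hP : P.IsStarAboutZero) (i : Fin n) (x : Plane) :
    x ∈ segment ℝ (P i) (P (finRotate n i)) ↔
      x ∈ P.sector i ∧ P.edgeForm i x = cross (P i) (P (finRotate n i)) := by
  have hD := hP.cross_pos i
  constructor
  · rintro ⟨s, t, hs, ht, hst, rfl⟩
    have h1 : cross (P i) (s • P i + t • P (finRotate n i)) =
        t * cross (P i) (P (finRotate n i)) := by simp [cross]; ring
    have h2 : cross (s • P i + t • P (finRotate n i)) (P (finRotate n i)) =
        s * cross (P i) (P (finRotate n i)) := by simp [cross]; ring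
    refine ⟨⟨?_, ?_⟩, ?_⟩
    · rw [h1]; positivity
    · rw [h2]; positivity
    · rw [edgeForm, h1, h2, ← add_mul, add_comm t, hst, one_mul]
  · rintro ⟨⟨h1, h2⟩, h3⟩
    refine ⟨cross x (P (finRotate n i)) / cross (P i) (P (finRotate n i)),
      cross (P i) x / cross (P i) (P (finRotate n i)), by positivity, by positivity, ?_, ?_⟩
    · rw [← add_div, div_eq_one_iff_eq hD.ne', add_comm]; exact h3
    · have := cross_smul_eq (P i) (P (finRotate n i)) x
      simp only [div_eq_inv_mul, mul_smul, ← smul_add]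
      rw [← this, smul_smul, inv_mul_cancel₀ hD.ne', one_smul]

theorem mem_boundary_iff (hP : P.IsStarAboutZero) (x : Plane) :
    x ∈ P.boundary ℝ ↔
      ∃ i, x ∈ P.sector i ∧ P.edgeForm i x = cross (P i) (P (finRotate n i)) := by
  simp only [boundary_eq, Set.mem_iUnion, hP.mem_segment_iff]

/-- `consistent` makes the quotient of `edgeForm` by the determinant independent of the sector. The
universal form exhibits the complement as a finite union of closed sets. -/
theorem mem_starRegion_iff_forall (hP : P.IsStarAboutZero) (x : Plane) :
    x ∈ P.starRegion ↔
      ∀ i, x ∈ P.sector i → P.edgeForm i x < cross (P i) (P (finRotate n i)) := by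
  constructor
  · rintro ⟨j, hj, hlt⟩ i hi
    have h := hP.consistent i j x hi hj
    have hi' := hP.cross_pos i
    have hj' := hP.cross_pos j
    by_contra! hge
    nlinarith [mul_lt_mul_of_pos_right hlt hi', mul_le_mul_of_nonneg_right hge hj'.le]
  · intro h
    obtain ⟨i, hi⟩ := hP.cover x
    exact ⟨i, hi, h i hi⟩

theorem isOpen_starRegion (hP : P.IsStarAboutZero) : IsOpen P.starRegion := by
  have : P.starRegion =
      (⋃ i, P.sector i ∩ {x | cross (P i) (P (finRotate n i)) ≤ P.edgeForm i x})ᶜ := by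
    ext x
    simp [hP.mem_starRegion_iff_forall]
  rw [this, isOpen_compl_iff]
  exact isClosed_iUnion_of_finite fun i =>
    (P.isClosed_sector i).inter (isClosed_le continuous_const (P.continuous_edgeForm i))

theorem isBounded_starRegion (hP : P.IsStarAboutZero) : Bornology.IsBounded P.starRegion := by
  rw [isBounded_iff_forall_norm_le]
  refine ⟨∑ i, ‖P i‖ + ∑ i, ‖P i‖, ?_⟩
  rintro x ⟨i, ⟨h1, h2⟩, h3⟩
  have hD := hP.cross_pos i
  have hle : ∀ j, ‖P j‖ ≤ ∑ i, ‖P i‖ := fun j =>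
    Finset.single_le_sum (f := fun i => ‖P i‖) (fun i _ => norm_nonneg _) (Finset.mem_univ j)
  have hx := congrArg norm (cross_smul_eq (P i) (P (finRotate n i)) x)
  have hn := norm_add_le (cross x (P (finRotate n i)) • P i) (cross (P i) x • P (finRotate n i))
  rw [← hx, norm_smul, norm_smul, norm_smul, Real.norm_of_nonneg hD.le, Real.norm_of_nonneg h1,
    Real.norm_of_nonneg h2] at hn
  rw [edgeForm] at h3
  have hb := mul_le_mul_of_nonneg_right (show cross x (P (finRotate n i)) ≤
    cross (P i) (P (finRotate n i)) by linarith) (norm_nonneg (P i))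
  have hc := mul_le_mul_of_nonneg_right (show cross (P i) x ≤
    cross (P i) (P (finRotate n i)) by linarith) (norm_nonneg (P (finRotate n i)))
  have : cross (P i) (P (finRotate n i)) * ‖x‖ ≤
      cross (P i) (P (finRotate n i)) * (‖P i‖ + ‖P (finRotate n i)‖) := by linarith
  have := le_of_mul_le_mul_left this hD
  linarith [hle i, hle (finRotate n i)]

theorem starRegion_subset_compl_boundary (hP : P.IsStarAboutZero) :
    P.starRegion ⊆ (P.boundary ℝ)ᶜ := by
  intro x hx hb
  obtain ⟨i, hi, he⟩ := (hP.mem_boundary_iff x).1 hb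
  exact ((hP.mem_starRegion_iff_forall x).1 hx i hi).ne he

theorem zero_mem_starRegion (hP : P.IsStarAboutZero) : (0 : Plane) ∈ P.starRegion := by
  obtain ⟨i, hi⟩ := hP.cover 0
  exact ⟨i, hi, by simpa [edgeForm] using hP.cross_pos i⟩

theorem smul_mem_starRegion {t : ℝ} (hP : P.IsStarAboutZero) (ht : 0 ≤ t)
    (ht1 : t ≤ 1) {x : Plane} (hx : x ∈ P.starRegion) : t • x ∈ P.starRegion := by
  obtain ⟨i, hi, hlt⟩ := hx
  refine ⟨i, smul_mem_sector ht hi, ?_⟩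
  rw [edgeForm_smul]
  have := hP.cross_pos i
  rcases le_or_gt 0 (P.edgeForm i x) with h | h
  · nlinarith
  · nlinarith

/-- Off the boundary the gauge is either below 1 or above 1, and both conditions are open, so a
component that meets the star region stays in this bounded set. -/
theorem starRegion_subset_interiorRegion (hP : P.IsStarAboutZero) :
    P.starRegion ⊆ P.interiorRegion := by
  intro x hx
  have hxb := hP.starRegion_subset_compl_boundary hx
  refine ⟨hxb, hP.isBounded_starRegion.subset ?_⟩
  let F : Set Plane :=
    ⋃ i, P.sector i ∩ {x | P.edgeForm i x ≤ cross (P i) (P (finRotate n i))}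
  have hF : IsClosed F := isClosed_iUnion_of_finite fun i =>
    (P.isClosed_sector i).inter (isClosed_le (P.continuous_edgeForm i) continuous_const)
  refine IsPreconnected.subset_left_of_subset_union hP.isOpen_starRegion hF.isOpen_compl ?_ ?_
    ⟨x, mem_connectedComponentIn hxb, hx⟩ isPreconnected_connectedComponentIn
  · rw [Set.disjoint_left]
    rintro y ⟨i, hi, hlt⟩ hy
    exact hy (Set.mem_iUnion.2 ⟨i, hi, hlt.le⟩)
  · intro y hy
    have hyb := connectedComponentIn_subset _ _ hy
    by_cases hyF : y ∈ F
    · obtain ⟨i, hi, hle⟩ := Set.mem_iUnion.1 hyF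
      exact Or.inl ⟨i, hi, lt_of_le_of_ne hle fun h => hyb ((hP.mem_boundary_iff y).2 ⟨i, hi, h⟩)⟩
    · exact Or.inr hyF

/-- From a point with gauge above 1, the ray pointing away from the origin never meets the boundary,
so its component is unbounded. -/
theorem interiorRegion_subset_starRegion (hP : P.IsStarAboutZero) :
    P.interiorRegion ⊆ P.starRegion := by
  rintro x ⟨hxb, hbd⟩
  by_contra hx
  have hx0 : x ≠ 0 := by
    rintro rfl
    exact hx hP.zero_mem_starRegion
  have hray : (fun t : ℝ => t • x) '' Set.Ici 1 ⊆ (P.boundary ℝ)ᶜ := by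
    rintro _ ⟨t, ht, rfl⟩ hb
    have ht1 : (1 : ℝ) ≤ t := ht
    have ht0 : 0 < t := by linarith
    obtain ⟨i, hi, he⟩ := (hP.mem_boundary_iff _).1 hb
    have hxi : x ∈ P.sector i := by
      have := smul_mem_sector (inv_nonneg.2 ht0.le) hi
      rwa [smul_smul, inv_mul_cancel₀ ht0.ne', one_smul] at this
    rw [edgeForm_smul] at he
    have hpos := hP.cross_pos i
    have hle : P.edgeForm i x ≤ cross (P i) (P (finRotate n i)) := by nlinarith
    rcases hle.eq_or_lt with h | h
    · exact hxb ((hP.mem_boundary_iff x).2 ⟨i, hxi, h⟩)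
    · exact hx ⟨i, hxi, h⟩
  have hsub := ((isPreconnected_Ici (a := (1 : ℝ))).image (fun t : ℝ => t • x)
    (by fun_prop)).subset_connectedComponentIn (x := x) ⟨1, by simp, by simp⟩ hray
  obtain ⟨C, hC⟩ := isBounded_iff_forall_norm_le.1 (hbd.subset hsub)
  have hn : 0 < ‖x‖ := norm_pos_iff.2 hx0
  have hC0 : 0 < C + 1 := by
    have := hC x ⟨1, by simp, by simp⟩
    linarith
  -- This point of the ray has norm `‖x‖ + C + 1`, which exceeds the bound `C`.
  have h := hC ((1 + (C + 1) / ‖x‖) • x) ⟨_, by simpa using by positivity, rfl⟩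
  rw [norm_smul, Real.norm_of_nonneg (by positivity), add_mul, div_mul_cancel₀ _ hn.ne'] at h
  linarith

theorem interiorRegion_eq (hP : P.IsStarAboutZero) : P.interiorRegion = P.starRegion :=
  hP.interiorRegion_subset_starRegion.antisymm hP.starRegion_subset_interiorRegion

theorem isStarshaped (hP : P.IsStarAboutZero) : P.IsStarshaped := by
  refine ⟨0, hP.starRegion_subset_interiorRegion hP.zero_mem_starRegion, ?_⟩
  rintro x hx _ ⟨s, t, hs, ht, hst, rfl⟩
  rw [hP.interiorRegion_eq] at hx ⊢
  rw [smul_zero, zero_add]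
  exact hP.smul_mem_starRegion ht.le (by linarith) hx

end IsStarAboutZero

/-! ### Criteria for seeing and not seeing -/

/-- An open segment is connected: if it avoids the boundary, one interior point on it places all of
it in the same bounded component. -/
theorem sees_of_disjoint_edges {P : Polygon Plane n} {p q m : Plane}
    (hm : m ∈ openSegment ℝ p q) (hmi : m ∈ P.interiorRegion)
    (h : ∀ i, Disjoint (openSegment ℝ p q) (segment ℝ (P i) (P (finRotate n i)))) :
    P.Sees p q := by
  have hsub : openSegment ℝ p q ⊆ (P.boundary ℝ)ᶜ := by
    intro y hy hb
    rw [boundary_eq] at hb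
    obtain ⟨i, hi⟩ := Set.mem_iUnion.1 hb
    exact Set.disjoint_left.1 (h i) hy hi
  intro y hy
  have hc := (convex_openSegment p q).isPreconnected.subset_connectedComponentIn hm hsub hy
  refine ⟨hsub hy, ?_⟩
  rw [← connectedComponentIn_eq hc]
  exact hmi.2

theorem not_sees_of_mem_edge {P : Polygon Plane n} {p q y : Plane} {i : Fin n}
    (hy : y ∈ openSegment ℝ p q) (hi : y ∈ segment ℝ (P i) (P (finRotate n i))) :
    ¬ P.Sees p q := by
  intro h
  apply (h hy).1
  rw [boundary_eq]
  exact Set.mem_iUnion.2 ⟨i, hi⟩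

end Polygon

/-! ### A finite criterion for being star-shaped about the origin -/

namespace Polygon

variable {n : ℕ}

open Fin.CommRing in
-- If no sector contained `x`, then `cross (P i) x`, once nonnegative, would be positive at the next
-- vertex and so all the way round. But these values sum to zero.
theorem exists_mem_sector [NeZero n] {P : Polygon Plane n} (hP : ∑ i, P i = 0) (x : Plane) :
    ∃ i, x ∈ P.sector i := by
  by_contra! hx
  have hsum : ∑ i, cross (P i) x = 0 := by
    have h0 : ∑ i, P i 0 = 0 := by simpa using congrArg (fun p : Plane => p 0) hP
    have h1 : ∑ i, P i 1 = 0 := by simpa using congrArg (fun p : Plane => p 1) hP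
    simp only [cross, Finset.sum_sub_distrib, ← Finset.sum_mul, h0, h1, zero_mul, sub_zero]
  have hstep : ∀ i, 0 ≤ cross (P i) x → 0 < cross (P (i + 1)) x := by
    intro i hi
    by_contra! h
    refine hx i ⟨hi, ?_⟩
    rw [finRotate_apply]
    simp only [cross] at h ⊢
    linarith
  obtain ⟨i, -, hi⟩ : ∃ i ∈ Finset.univ, 0 ≤ cross (P i) x := by
    apply Finset.exists_le_of_sum_le (f := fun _ => (0 : ℝ)) ⟨0, Finset.mem_univ _⟩
    simp [hsum]
  have hall : ∀ k : ℕ, 0 < cross (P (i + 1 + (k : Fin n))) x := by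
    intro k
    induction k with
    | zero => simpa using hstep i hi
    | succ k ih => simpa [add_assoc] using hstep _ ih.le
  have : 0 < ∑ j, cross (P j) x := by
    refine Finset.sum_pos (fun j _ => ?_) ⟨0, Finset.mem_univ _⟩
    have h := hall (j - (i + 1) : Fin n).val
    rwa [Fin.cast_val_eq_self, add_sub_cancel] at h
  exact this.ne' hsum

/-- A common point of two consecutive sectors is collinear with the shared vertex, where the two
gauges agree. -/
theorem edgeForm_eq_of_consecutive {P : Polygon Plane n} {i j : Fin n}
    (hij : finRotate n i = j) {x : Plane}
    (hxi : x ∈ P.sector i) (hxj : x ∈ P.sector j) :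
    P.edgeForm i x * cross (P j) (P (finRotate n j)) =
      P.edgeForm j x * cross (P i) (P (finRotate n i)) := by
  subst hij
  have h0 : cross x (P (finRotate n i)) = 0 := by
    have h1 := hxi.2
    have h2 := hxj.1
    simp only [cross] at h1 h2 ⊢
    linarith
  have hx := cross_smul_eq (P i) (P (finRotate n i)) x
  rw [h0, zero_smul, zero_add] at hx
  have h3 := congrArg (fun y => cross y (P (finRotate n (finRotate n i)))) hx
  simp only [cross_smul_left] at h3
  have h4 : cross (P (finRotate n i)) x = 0 := by
    simp only [cross] at h0 ⊢
    linarith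
  simp only [edgeForm, h0, h4]
  linarith

/-- The line through the origin in direction `m` strictly separates the two edges. As `x` is a
nonnegative combination of the endpoints of either edge, it lies weakly on both sides, which forces
its coefficients to vanish. -/
theorem cross_eq_zero_of_mem_sector_of_separated {P : Polygon Plane n} {i j : Fin n} {m x : Plane}
    (hi : 0 < cross (P i) (P (finRotate n i))) (hj : 0 < cross (P j) (P (finRotate n j)))
    (h1 : cross m (P i) < 0) (h2 : cross m (P (finRotate n i)) < 0)
    (h3 : 0 < cross m (P j)) (h4 : 0 < cross m (P (finRotate n j)))
    (hxi : x ∈ P.sector i) (hxj : x ∈ P.sector j) : x = 0 := by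
  have key : ∀ k, cross (P k) (P (finRotate n k)) * cross m x =
      cross x (P (finRotate n k)) * cross m (P k) + cross (P k) x * cross m (P (finRotate n k)) := by
    intro k
    simp only [cross]; ring
  have ki := key i
  have kj := key j
  have n1 := mul_nonneg hxj.2 h3.le
  have n2 := mul_nonneg hxj.1 h4.le
  have hm : 0 ≤ cross m x := by
    by_contra! h
    nlinarith
  have p1 := mul_nonneg hxi.2 (neg_nonneg.2 h1.le)
  have p2 := mul_nonneg hxi.1 (neg_nonneg.2 h2.le)
  have p3 := mul_nonneg hi.le hm
  have z1 : cross x (P (finRotate n i)) = 0 := by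
    have : cross x (P (finRotate n i)) * -cross m (P i) = 0 := by linarith
    exact (mul_eq_zero.1 this).resolve_right (neg_ne_zero.2 h1.ne)
  have z2 : cross (P i) x = 0 := by
    have : cross (P i) x * -cross m (P (finRotate n i)) = 0 := by linarith
    exact (mul_eq_zero.1 this).resolve_right (neg_ne_zero.2 h2.ne)
  have hx := cross_smul_eq (P i) (P (finRotate n i)) x
  rw [z1, z2, zero_smul, zero_smul, add_zero] at hx
  exact (smul_eq_zero.1 hx).resolve_left hi.ne'

theorem isStarAboutZero_of_sum_eq_zero [NeZero n] {P : Polygon Plane n}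
    (hpos : ∀ i, 0 < cross (P i) (P (finRotate n i))) (hsum : ∑ i, P i = 0)
    (hsep : ∀ i j, i ≠ j → finRotate n i ≠ j → finRotate n j ≠ i →
      ∃ m, cross m (P i) < 0 ∧ cross m (P (finRotate n i)) < 0 ∧
        0 < cross m (P j) ∧ 0 < cross m (P (finRotate n j))) :
    P.IsStarAboutZero where
  cross_pos := hpos
  cover := exists_mem_sector hsum
  consistent i j x hxi hxj := by
    by_cases h : i = j
    · rw [h]
    by_cases h' : finRotate n i = j
    · exact edgeForm_eq_of_consecutive h' hxi hxj
    by_cases h'' : finRotate n j = i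
    · exact (edgeForm_eq_of_consecutive h'' hxj hxi).symm
    obtain ⟨m, h1, h2, h3, h4⟩ := hsep i j h h' h''
    obtain rfl :=
      cross_eq_zero_of_mem_sector_of_separated (hpos i) (hpos j) h1 h2 h3 h4 hxi hxj
    simp [edgeForm]

end Polygon

/-! ### Exhaustive search for a conflict-free selection -/

/-- Backtracking search for a selection of one element from each of the given lists which extends
a given one and in which no element conflicts with an earlier one; the value is `true` if there is
no such selection. -/
def noSelection {α : Type*} (conflict : α → α → Bool) : List (List α) → List α → Bool
  | [], _ => false
  | l :: ls, chosen => l.all fun a => chosen.any (conflict a) || noSelection conflict ls (a :: chosen)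

theorem not_selection_of_noSelection {α : Type*} {conflict : α → α → Bool} {S : Set α}
    (hS : ∀ a ∈ S, ∀ b ∈ S, conflict a b = false) :
    ∀ (ls : List (List α)) (chosen : List α), (∀ a ∈ chosen, a ∈ S) →
      noSelection conflict ls chosen = true → ¬ ∀ l ∈ ls, ∃ a ∈ S, a ∈ l
  | [], _, _, h => by simp [noSelection] at h
  | l :: ls, chosen, hc, h => by
    intro hl
    obtain ⟨a, haS, hal⟩ := hl l (by simp)
    rw [noSelection, List.all_eq_true] at h
    have ha := h a hal
    rw [Bool.or_eq_true, List.any_eq_true] at ha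
    rcases ha with ⟨b, hb, hab⟩ | ha
    · simp [hS a haS b (hc b hb)] at hab
    · refine not_selection_of_noSelection hS ls (a :: chosen) ?_ ha
        fun l' hl' => hl l' (by simp [hl'])
      intro b hb
      rcases List.mem_cons.1 hb with rfl | hb
      exacts [haS, hc b hb]

/-! ### Decidable tests in integer coordinates -/

/-- The point of the plane with the given integer coordinates. -/
noncomputable def toPlane (a : ℤ × ℤ) : Plane := !₂[(a.1 : ℝ), (a.2 : ℝ)]

/-- The determinant of two integer vectors. -/
def intCross (a b : ℤ × ℤ) : ℤ := a.1 * b.2 - a.2 * b.1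

/-- Twice the signed area of a triangle with integer vertices. -/
def intOrient (a b c : ℤ × ℤ) : ℤ :=
  (b.1 - a.1) * (c.2 - a.2) - (b.2 - a.2) * (c.1 - a.1)

theorem cross_toPlane (a b : ℤ × ℤ) : cross (toPlane a) (toPlane b) = intCross a b := by
  simp [cross, toPlane, intCross]

theorem orient_toPlane (a b c : ℤ × ℤ) :
    orient (toPlane a) (toPlane b) (toPlane c) = intOrient a b c := by
  simp [orient_eq, toPlane, intOrient]

theorem toPlane_zero : toPlane 0 = 0 := by
  apply plane_ext <;> simp [toPlane]

theorem toPlane_add (a b : ℤ × ℤ) : toPlane (a + b) = toPlane a + toPlane b := by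
  apply plane_ext <;> simp [toPlane]

/-- The segment `c d` avoids the open segment `p q` because of the position of `c`, `d` relative to
the line through `p` and `q`, or of `p`, `q` relative to the line through `c` and `d`. -/
def Avoids (p q c d : ℤ × ℤ) : Prop :=
  0 < intOrient p q c * intOrient p q d ∨
  (0 ≤ intOrient c d p ∧ 0 ≤ intOrient c d q ∧ 0 < intOrient c d p + intOrient c d q) ∨
  (0 ≤ intOrient d c p ∧ 0 ≤ intOrient d c q ∧ 0 < intOrient d c p + intOrient d c q)

instance (p q c d : ℤ × ℤ) : Decidable (Avoids p q c d) := by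
  unfold Avoids; infer_instance

theorem Avoids.disjoint {p q c d : ℤ × ℤ} (h : Avoids p q c d) :
    Disjoint (openSegment ℝ (toPlane p) (toPlane q)) (segment ℝ (toPlane c) (toPlane d)) := by
  rcases h with h | ⟨h1, h2, h3⟩ | ⟨h1, h2, h3⟩
  · refine (disjoint_segment_of_orient_mul_pos ?_).mono_left (openSegment_subset_segment ℝ _ _)
    simp only [orient_toPlane]; exact_mod_cast h
  · apply disjoint_openSegment_segment <;> simp only [orient_toPlane] <;> exact_mod_cast ‹_›
  · rw [segment_symm]
    apply disjoint_openSegment_segment <;> simp only [orient_toPlane] <;> exact_mod_cast ‹_›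

/-- The segment `c d` crosses every open segment from `x` to a point strictly between `a` and
`b`. -/
def Blocks (x a b c d : ℤ × ℤ) : Prop :=
  0 < intOrient c d x ∧ intOrient c d a ≤ 0 ∧ intOrient c d b ≤ 0 ∧
    intOrient c d a + intOrient c d b < 0 ∧ intOrient x a c ≤ 0 ∧ intOrient x b c ≤ 0 ∧
    0 ≤ intOrient x a d ∧ 0 ≤ intOrient x b d

instance (x a b c d : ℤ × ℤ) : Decidable (Blocks x a b c d) := by
  unfold Blocks; infer_instance

theorem Blocks.exists_mem {x a b c d : ℤ × ℤ} (h : Blocks x a b c d) {p : Plane}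
    (hp : p ∈ openSegment ℝ (toPlane a) (toPlane b)) :
    ∃ y ∈ openSegment ℝ (toPlane x) p, y ∈ segment ℝ (toPlane c) (toPlane d) := by
  obtain ⟨h1, h2, h3, h4, h5, h6, h7, h8⟩ := h
  apply exists_mem_openSegment_mem_segment (hp := hp) <;> simp only [orient_toPlane] <;>
    exact_mod_cast ‹_›

namespace Polygon

/-- The polygon with the given integer vertices. -/
noncomputable def ofInt {n : ℕ} (v : Fin n → ℤ × ℤ) : Polygon Plane n := ⟨fun i => toPlane (v i)⟩

@[simp] theorem ofInt_apply {n : ℕ} (v : Fin n → ℤ × ℤ) (i : Fin n) :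
    ofInt v i = toPlane (v i) := rfl

variable {n : ℕ} [NeZero n] {v : Fin n → ℤ × ℤ}

theorem isSimple_ofInt (hn : ∀ i, intOrient (v i) (v (i + 1)) (v (i + 1 + 1)) ≠ 0)
    (hd : ∀ i j, i ≠ j → j ≠ i + 1 → i ≠ j + 1 →
      0 < intOrient (v i) (v (i + 1)) (v j) * intOrient (v i) (v (i + 1)) (v (j + 1)) ∨
      0 < intOrient (v j) (v (j + 1)) (v i) * intOrient (v j) (v (j + 1)) (v (i + 1))) :
    (ofInt v).IsSimple := by
  have hn' : ∀ i, orient (toPlane (v i)) (toPlane (v (i + 1))) (toPlane (v (i + 1 + 1))) ≠ 0 := by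
    intro i
    rw [orient_toPlane]
    exact_mod_cast hn i
  refine ⟨fun i => ?_, fun i => ?_, fun i j h1 h2 h3 => ?_⟩
  · have : i + 2 = i + 1 + 1 := by simp [Fin.ext_iff, Fin.val_add, Fin.coe_ofNat_eq_mod, add_assoc]
    rw [this]
    exact affineIndependent_of_orient_ne_zero (hn' i)
  · simp only [edgeSet_eq_segment, finRotate_apply, ofInt_apply]
    exact segment_inter_segment_of_orient_ne_zero (hn' i)
  · simp only [finRotate_apply] at h2 h3
    simp only [edgeSet_eq_segment, finRotate_apply, ofInt_apply]
    rcases hd i j h1 h2 h3 with h | h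
    · apply disjoint_segment_of_orient_mul_pos
      simp only [orient_toPlane]; exact_mod_cast h
    · apply Disjoint.symm
      apply disjoint_segment_of_orient_mul_pos
      simp only [orient_toPlane]; exact_mod_cast h

theorem isCounterclockwise_ofInt (h : ∀ i, 0 < intCross (v i) (v (i + 1))) :
    (ofInt v).IsCounterclockwise := by
  refine Finset.sum_pos (fun i _ => ?_) ⟨0, Finset.mem_univ _⟩
  have h1 : (0 : ℝ) < intCross (v i) (v (i + 1)) := by exact_mod_cast h i
  rw [← cross_toPlane, cross] at h1
  simp only [finRotate_apply, ofInt_apply]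
  linarith

/-- The direction `m` has the edge `a b` on its right and the edge `c d` on its left. -/
def Separates (m a b c d : ℤ × ℤ) : Prop :=
  intCross m a < 0 ∧ intCross m b < 0 ∧ 0 < intCross m c ∧ 0 < intCross m d

instance (m a b c d : ℤ × ℤ) : Decidable (Separates m a b c d) := by
  unfold Separates; infer_instance

theorem isStarAboutZero_ofInt (hpos : ∀ i, 0 < intCross (v i) (v (i + 1))) (hsum : ∑ i, v i = 0)
    (hsep : ∀ i j, i ≠ j → i + 1 ≠ j → j + 1 ≠ i →
      Separates (v (i + 1) + v j) (v i) (v (i + 1)) (v j) (v (j + 1)) ∨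
      Separates (-(v i + v (j + 1))) (v i) (v (i + 1)) (v j) (v (j + 1))) :
    (ofInt v).IsStarAboutZero := by
  apply isStarAboutZero_of_sum_eq_zero
  · intro i
    simp only [finRotate_apply, ofInt_apply, cross_toPlane]
    exact_mod_cast hpos i
  · let f : ℤ × ℤ →+ Plane := ⟨⟨toPlane, toPlane_zero⟩, toPlane_add⟩
    have := congrArg f hsum
    rwa [map_sum, map_zero] at this
  · intro i j h1 h2 h3
    simp only [finRotate_apply, ofInt_apply] at h2 h3 ⊢
    -- The direction is found in one of the two angular gaps between the edges, as the sum of the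
    -- vertices bounding that gap, negated for the gap from edge `j` to edge `i`.
    obtain ⟨m, h4, h5, h6, h7⟩ : ∃ m, Separates m (v i) (v (i + 1)) (v j) (v (j + 1)) :=
      (hsep i j h1 h2 h3).elim (fun h => ⟨_, h⟩) fun h => ⟨_, h⟩
    refine ⟨toPlane m, ?_⟩
    simp only [cross_toPlane]
    exact ⟨by exact_mod_cast h4, by exact_mod_cast h5, by exact_mod_cast h6,
      by exact_mod_cast h7⟩

/-- A test for `a / t` to be an interior point of the star-shaped polygon with vertices `v`. -/
def Inside (v : Fin n → ℤ × ℤ) (t : ℤ) (a : ℤ × ℤ) : Prop :=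
  ∃ i, 0 ≤ intCross (v i) a ∧ 0 ≤ intCross a (v (i + 1)) ∧
    intCross (v i) a + intCross a (v (i + 1)) < t * intCross (v i) (v (i + 1))

instance (t : ℤ) (a : ℤ × ℤ) : Decidable (Inside v t a) := by
  unfold Inside; infer_instance

theorem Inside.smul_mem_interiorRegion (hv : (ofInt v).IsStarAboutZero) {t : ℤ} (ht : 0 < t)
    {a : ℤ × ℤ} (h : Inside v t a) : (t : ℝ)⁻¹ • toPlane a ∈ (ofInt v).interiorRegion := by
  have ht' : (0 : ℝ) < t := by exact_mod_cast ht
  obtain ⟨i, h1, h2, h3⟩ := h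
  refine hv.starRegion_subset_interiorRegion
    ⟨i, smul_mem_sector (inv_nonneg.2 ht'.le) ⟨?_, ?_⟩, ?_⟩
  · rw [ofInt_apply, cross_toPlane]; exact_mod_cast h1
  · rw [finRotate_apply, ofInt_apply, cross_toPlane]; exact_mod_cast h2
  · rw [edgeForm_smul, inv_mul_lt_iff₀ ht']
    simp only [edgeForm, finRotate_apply, ofInt_apply, cross_toPlane]
    exact_mod_cast h3

/-- The interior point on the segment is its midpoint, whence the denominator 2. -/
theorem sees_ofInt (hv : (ofInt v).IsStarAboutZero) {p q : ℤ × ℤ} (hpq : Inside v 2 (p + q))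
    (h : ∀ i, Avoids p q (v i) (v (i + 1))) : (ofInt v).Sees (toPlane p) (toPlane q) := by
  refine sees_of_disjoint_edges ?_ (hpq.smul_mem_interiorRegion hv two_pos) fun i => ?_
  · refine ⟨2⁻¹, 2⁻¹, by norm_num, by norm_num, by norm_num, ?_⟩
    rw [toPlane_add, smul_add]
    norm_num
  · rw [finRotate_apply]
    exact (h i).disjoint

theorem not_sees_ofInt {x : ℤ × ℤ} {e i : Fin n}
    (h : Blocks x (v e) (v (e + 1)) (v i) (v (i + 1)) ∨
      Blocks x (v e) (v (e + 1)) (v (i + 1)) (v i)) {p : Plane} (hp : p ∈ (ofInt v).openEdge e) :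
    ¬ (ofInt v).Sees (toPlane x) p := by
  rw [openEdge, finRotate_apply] at hp
  obtain ⟨y, hy, hyi⟩ : ∃ y ∈ openSegment ℝ (toPlane x) p,
      y ∈ segment ℝ (toPlane (v i)) (toPlane (v (i + 1))) := by
    rcases h with h | h
    · exact h.exists_mem hp
    · rw [segment_symm]
      exact h.exists_mem hp
  exact not_sees_of_mem_edge (i := i) hy (by rw [finRotate_apply]; exact hyi)

end Polygon

/-! ### The star, its witnesses and its sightlines -/

/-- A linear map of order three with integer coefficients. -/
def turn (a : ℤ × ℤ) : ℤ × ℤ := (-a.2, a.1 - a.2)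

/-- One third of the vertices; the others are its images under `turn`. -/
def starBase : List (ℤ × ℤ) := [(5, -2), (134, 84), (7, 9), (65, 128), (5, 14), (14, 41)]

/-- The vertices of the star, before scaling. -/
def starVertex (i : Fin 18) : ℤ × ℤ :=
  (starBase ++ starBase.map turn ++ starBase.map fun a => turn (turn a)).getD i 0

/-- The vertices of a star with nine spikes. -/
def spiked (i : Fin 18) : ℤ × ℤ := (100 * (starVertex i).1, 100 * (starVertex i).2)

/-- The point dividing the `i`-th edge of the spiked in the ratio `k : 100 - k`. -/
def starEdgePoint (i : Fin 18) (k : ℤ) : ℤ × ℤ :=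
  ((100 - k) * (starVertex i).1 + k * (starVertex (i + 1)).1,
    (100 - k) * (starVertex i).2 + k * (starVertex (i + 1)).2)

/-- Interior points of the star together with lists of edges containing all those which see them,
up to symmetry. -/
def witnessBase : List ((ℤ × ℤ) × List (Fin 18)) :=
  [((12730, 7980), [0, 1, 7, 9, 10, 12]), ((6175, 12160), [2, 3, 5, 6, 12]),
    ((1330, 3895), [4, 5, 13]), ((-2300, 800), [0, 6, 7, 13, 15, 17]),
    ((-400, 800), [0, 6, 7, 11, 13, 14])]

/-- The symmetry of order three on `witnessBase`. -/
def turnWitness (w : (ℤ × ℤ) × List (Fin 18)) : (ℤ × ℤ) × List (Fin 18) :=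
  (turn w.1, w.2.map (· + 6))

/-- Interior points of the star together with lists of edges containing all those which see
them. -/
def witnesses : List ((ℤ × ℤ) × List (Fin 18)) :=
  witnessBase ++ witnessBase.map turnWitness ++ witnessBase.map fun w => turnWitness (turnWitness w)

/-- Pairs of edges of the star and parameters of points on them which see each other, up to
symmetry. -/
def sightlineBase : List (Fin 18 × Fin 18 × ℤ × ℤ) :=
  [(0, 1, 50, 50), (0, 3, 1, 99), (0, 6, 1, 50), (0, 10, 50, 5), (1, 9, 50, 80), (1, 11, 50, 50),
    (1, 14, 99, 1), (2, 9, 1, 95), (2, 11, 5, 80), (3, 5, 50, 95), (4, 5, 50, 50)]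

/-- Pairs of edges of the star and parameters of points on them which see each other. -/
def sightlines : List (Fin 18 × Fin 18 × ℤ × ℤ) :=
  sightlineBase ++ sightlineBase.map (fun s => (s.1 + 6, s.2.1 + 6, s.2.2)) ++
    sightlineBase.map fun s => (s.1 + 12, s.2.1 + 12, s.2.2)

/-- Two edges of the star are joined by one of the given sightlines. -/
def starConflict (i j : Fin 18) : Bool :=
  sightlines.any fun s => (s.1 == i && s.2.1 == j) || (s.1 == j && s.2.1 == i)

/-! ### Finite verification and conclusion -/

theorem spiked_corner : ∀ i, intOrient (spiked i) (spiked (i + 1)) (spiked (i + 1 + 1)) ≠ 0 := by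
  decide +kernel

theorem spiked_disjoint : ∀ i j, i ≠ j → j ≠ i + 1 → i ≠ j + 1 →
    0 < intOrient (spiked i) (spiked (i + 1)) (spiked j) *
        intOrient (spiked i) (spiked (i + 1)) (spiked (j + 1)) ∨
      0 < intOrient (spiked j) (spiked (j + 1)) (spiked i) *
        intOrient (spiked j) (spiked (j + 1)) (spiked (i + 1)) := by
  decide +kernel

theorem spiked_cross_pos : ∀ i, 0 < intCross (spiked i) (spiked (i + 1)) := by
  decide +kernel

/-- The map `turn` satisfies `1 + T + T² = 0`, so every orbit of vertices sums to zero. -/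
theorem spiked_sum : ∑ i, spiked i = 0 := by
  decide +kernel

theorem spiked_separates : ∀ i j, i ≠ j → i + 1 ≠ j → j + 1 ≠ i →
    Polygon.Separates (spiked (i + 1) + spiked j) (spiked i) (spiked (i + 1)) (spiked j)
        (spiked (j + 1)) ∨
      Polygon.Separates (-(spiked i + spiked (j + 1))) (spiked i) (spiked (i + 1)) (spiked j)
        (spiked (j + 1)) := by
  decide +kernel

theorem inside_of_mem_witnesses : ∀ w ∈ witnesses, Polygon.Inside spiked 1 w.1 := by
  decide +kernel

theorem blocks_of_mem_witnesses : ∀ w ∈ witnesses, ∀ e, e ∉ w.2 → ∃ i,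
    Blocks w.1 (spiked e) (spiked (e + 1)) (spiked i) (spiked (i + 1)) ∨
      Blocks w.1 (spiked e) (spiked (e + 1)) (spiked (i + 1)) (spiked i) := by
  decide +kernel

theorem of_mem_sightlines : ∀ s ∈ sightlines,
    s.1 ≠ s.2.1 ∧ 0 < s.2.2.1 ∧ s.2.2.1 < 100 ∧ 0 < s.2.2.2 ∧ s.2.2.2 < 100 ∧
      Polygon.Inside spiked 2 (starEdgePoint s.1 s.2.2.1 + starEdgePoint s.2.1 s.2.2.2) ∧
      ∀ i, Avoids (starEdgePoint s.1 s.2.2.1) (starEdgePoint s.2.1 s.2.2.2)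
        (spiked i) (spiked (i + 1)) := by
  decide +kernel

theorem noSelection_witnesses :
    noSelection starConflict (witnesses.map Prod.snd) [] = true := by
  decide +kernel

theorem toPlane_starEdgePoint_mem (i : Fin 18) {k : ℤ} (h0 : 0 < k) (h1 : k < 100) :
    toPlane (starEdgePoint i k) ∈ (Polygon.ofInt spiked).openEdge i := by
  have h0' : (0 : ℝ) < k := by exact_mod_cast h0
  have h1' : (k : ℝ) < 100 := by exact_mod_cast h1
  -- The factor 100 in `spiked` cancels these denominators, which keeps the edge points integral.
  refine ⟨(100 - k) / 100, k / 100, by linarith, by linarith, by ring, ?_⟩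
  rw [finRotate_apply]
  apply plane_ext <;> simp [toPlane, starEdgePoint, spiked] <;> ring

theorem isStarAboutZero_spiked : (Polygon.ofInt spiked).IsStarAboutZero :=
  Polygon.isStarAboutZero_ofInt spiked_cross_pos spiked_sum spiked_separates

theorem exists_sees_of_starConflict {i j : Fin 18} (h : starConflict i j = true) :
    i ≠ j ∧ ∃ p ∈ (Polygon.ofInt spiked).openEdge i, ∃ q ∈ (Polygon.ofInt spiked).openEdge j,
      (Polygon.ofInt spiked).Sees p q := by
  rw [starConflict, List.any_eq_true] at h
  obtain ⟨⟨a, b, k, l⟩, hs, h⟩ := h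
  obtain ⟨hne, hk0, hk1, hl0, hl1, hin, hav⟩ := of_mem_sightlines _ hs
  have hsee := Polygon.sees_ofInt isStarAboutZero_spiked hin hav
  simp only [Bool.or_eq_true, Bool.and_eq_true, beq_iff_eq] at h
  have ha := toPlane_starEdgePoint_mem a hk0 hk1
  have hb := toPlane_starEdgePoint_mem b hl0 hl1
  rcases h with ⟨rfl, rfl⟩ | ⟨rfl, rfl⟩
  · exact ⟨hne, _, ha, _, hb, hsee⟩
  · refine ⟨hne.symm, _, hb, _, ha, ?_⟩
    rw [Polygon.Sees, openSegment_symm]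
    exact hsee

theorem mainTheorem6 :
    ∃ (n : ℕ) (_ : NeZero n) (P : Polygon Plane n),
      P.IsSimple ∧ P.IsCounterclockwise ∧ P.IsStarshaped ∧
        ¬ ∃ S : Set (Fin n), P.IsOpenEdgeGuardSet S ∧ P.IsHiddenOpenEdgeSet S := by
  refine ⟨18, inferInstance, Polygon.ofInt spiked,
    Polygon.isSimple_ofInt spiked_corner spiked_disjoint,
    Polygon.isCounterclockwise_ofInt spiked_cross_pos, isStarAboutZero_spiked.isStarshaped, ?_⟩
  rintro ⟨S, hguard, hhidden⟩
  have hS : ∀ i ∈ S, ∀ j ∈ S, starConflict i j = false := by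
    intro i hi j hj
    by_contra h
    obtain ⟨hij, hsee⟩ := exists_sees_of_starConflict (Bool.eq_true_of_not_eq_false h)
    exact hhidden i hi j hj hij hsee
  -- A guard set meets the list of every witness, whereas the search excludes this for a set without
  -- conflicts.
  refine not_selection_of_noSelection hS _ [] (by simp) noSelection_witnesses ?_
  intro l hl
  obtain ⟨w, hw, rfl⟩ := List.mem_map.1 hl
  have hx := (inside_of_mem_witnesses w hw).smul_mem_interiorRegion isStarAboutZero_spiked one_pos
  rw [Int.cast_one, inv_one, one_smul] at hx
  obtain ⟨e, heS, p, hp, hsee⟩ := hguard _ hx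
  refine ⟨e, heS, ?_⟩
  by_contra he
  obtain ⟨i, hi⟩ := blocks_of_mem_witnesses w hw e he
  exact Polygon.not_sees_ofInt hi hp hsee
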